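/- Let $\Gamma$ be a finitely generated group. A \emph{finite generating multi-set} $S$ of $\Gamma$ is a finite index set $S$ with a map $\alpha\colon S\to\Gamma$ whose image generates $\Gamma$ and an involution $s\mapsto s^{-1}$ of $S$ such that $\alpha(s^{-1})=\alpha(s)^{-1}$ for all $s$, and $s^{-1}\neq s$ whenever $\alpha(s)=1$. Its Cayley graph $\mathrm{Cay}(\Gamma,S)$ has vertex set $\Gamma$ and, for all $g\in\Gamma$ and $s\in S$, an oriented edge $(g,s)$ from $g$ to $\alpha(s)g$, with opposite edge $(\alpha(s)g,s^{-1})$; the set $E$ of edges consists of the unordered pairs of opposite oriented edges. A simple cycle is a non-empty closed path that visits no vertex twice and does not consist of an oriented edge followed by its opposite; so loops are simple cycles. Label the edges by independent uniformly distributed random variables in $[0,1]$ and delete every edge that carries a maximal label in some simple cycle through it. The law on $\{0,1\}^{E}$ of the remaining spanning subgraph is the free minimal spanning forest $\mathrm{FMSF}$ of $\mathrm{Cay}(\Gamma,S)$, and $\delta_{\mathrm{FMSF}}(\Gamma,S)$ denotes the expected degree of the vertex $1\in\Gamma$ in it (by vertex-transitivity every vertex gives the same value). Suppose that $\Gamma$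 is non-amenable, i.e. there is no left-invariant finitely additive probability measure defined on all subsets of $\Gamma$. Then $\delta_{\mathrm{FMSF}}(\Gamma,S)$ depends on the generating multi-set: there are finite generating multi-sets $S,T$ of $\Gamma$ with $\delta_{\mathrm{FMSF}}(\Gamma,S)\neq\delta_{\mathrm{FMSF}}(\Gamma,T)$. Moreover, for every $n\in\mathbb N$ there is a finite generating multi-set $S$ of $\Gamma$ with $n\le\delta_{\mathrm{FMSF}}(\Gamma,S)<\infty$. -/

import Mathlib

open MeasureTheory Set
open scoped ENNReal Pointwise

noncomputable section

/-- A (discrete) group is amenable if it carries a left-invariant, finitely additive probability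
measure defined on all of its subsets. -/
def IsAmenableGroup (Γ : Type*) [Group Γ] : Prop :=
  ∃ m : Set Γ → ℝ≥0∞, m univ = 1 ∧
    (∀ A B : Set Γ, Disjoint A B → m (A ∪ B) = m A + m B) ∧
    ∀ (g : Γ) (A : Set Γ), m (g • A) = m A

/-- A graph with vertex set `V` and set of oriented edges `O`; loops and multiple edges are allowed.
Every oriented edge `e` has a tail, a head, and an opposite oriented edge `opp e ≠ e`. -/
structure OrientedGraph (V O : Type*) where
  /-- the tail of an oriented edge -/
  tail : O → V
  /-- the head of an oriented edge -/
  head : O → V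
  /-- the opposite of an oriented edge -/
  opp : O → O
  opp_opp : ∀ e, opp (opp e) = e
  opp_ne : ∀ e, opp e ≠ e
  tail_opp : ∀ e, tail (opp e) = head e

namespace OrientedGraph

variable {V O : Type*} (G : OrientedGraph V O)

/-- The set of (unoriented) edges: the unordered pairs `{e, opp e}`. -/
def Edge : Type _ := {p : Sym2 O // ∃ e : O, p = s(e, G.opp e)}

/-- The edge underlying an oriented edge. -/
def edge (e : O) : G.Edge := ⟨s(e, G.opp e), e, rfl⟩

/-- `G.IsPath l x y`: the list of oriented edges `l` is a path from `x` to `y`. -/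
def IsPath : List O → V → V → Prop
  | [], x, y => x = y
  | e :: l, x, y => G.tail e = x ∧ IsPath l (G.head e) y

/-- A simple cycle: a nonempty closed path that visits no vertex twice and is not of the form
`(e, opp e)`. A loop is a simple cycle of length one, and two different parallel edges form a simple
cycle of length two. -/
def IsSimpleCycle (l : List O) : Prop :=
  l ≠ [] ∧ (∃ x, G.IsPath l x x) ∧ (l.map G.tail).Nodup ∧ ∀ e, l ≠ [e, G.opp e]

/-- The edge `a` is cut under the labelling `x` if it carries a maximal label in some simple cycle
that runs through it. -/
def IsCut (x : G.Edge → unitInterval) (a : G.Edge) : Prop :=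
  ∃ l, G.IsSimpleCycle l ∧ (∃ e ∈ l, G.edge e = a) ∧ ∀ f ∈ l, x (G.edge f) ≤ x a

/-- The spanning subgraph, given by its set of edges, that remains when every edge with a maximal
label in some simple cycle has been cut. -/
def survivors (x : G.Edge → unitInterval) : Set G.Edge := {a | ¬ G.IsCut x a}

/-- The free minimal spanning forest: the law of `survivors` when the labels of the edges are
independent and uniformly distributed on `[0,1]`. The space `Set G.Edge` carries the product
σ-algebra of `{0,1}^E`. -/
def FMSF : Measure (Set G.Edge) :=
  (Measure.infinitePi fun _ : G.Edge => (volume : Measure unitInterval)).map G.survivors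

/-- The degree of the vertex `x` in the spanning subgraph with edge set `ω`: the number of oriented
edges with tail `x` whose underlying edge lies in `ω`. -/
def degreeIn (ω : Set G.Edge) (x : V) : ℕ∞ := {e : O | G.tail e = x ∧ G.edge e ∈ ω}.encard

/-- The expected degree of the vertex `x` in the free minimal spanning forest. -/
def expectedDegree (x : V) : ℝ≥0∞ := ∫⁻ ω, (G.degreeIn ω x : ℝ≥0∞) ∂G.FMSF

end OrientedGraph

/-- A finite symmetric multi-set that generates the group `Γ`: a map `val` from a finite index set to
`Γ` whose image generates `Γ`, together with an involution `inv` of the index set such that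
`val (inv s) = (val s)⁻¹`. The last field says that no oriented edge of the Cayley graph
is its own opposite; it only concerns indices `s` with `val s = 1`. -/
structure GeneratingMultiset (Γ : Type*) [Group Γ] where
  /-- the index set of the multi-set -/
  Index : Type
  [finite : Finite Index]
  /-- the group element with a given index -/
  val : Index → Γ
  /-- the involution that implements `S = S⁻¹` -/
  inv : Index → Index
  inv_inv : ∀ s, inv (inv s) = s
  val_inv : ∀ s, val (inv s) = (val s)⁻¹
  closure_range : Subgroup.closure (range val) = ⊤
  inv_ne : ∀ s, val s = 1 → inv s ≠ s

namespace GeneratingMultiset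

variable {Γ : Type*} [Group Γ] (S : GeneratingMultiset Γ)

/-- The Cayley graph: for every `g : Γ` and every index `s` there is an oriented edge from `g` to
`s g`, whose opposite is the oriented edge from `s g` to `g` with index `s⁻¹`. -/
def cayley : OrientedGraph Γ (Γ × S.Index) where
  tail e := e.1
  head e := S.val e.2 * e.1
  opp e := (S.val e.2 * e.1, S.inv e.2)
  opp_opp e := by simp [S.inv_inv, S.val_inv]
  opp_ne e h := by
    have h1 := congrArg Prod.fst h
    have h2 := congrArg Prod.snd h
    simp only [mul_eq_right] at h1
    exact S.inv_ne e.2 h1 h2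
  tail_opp _ := rfl

/-- The expected degree of the free minimal spanning forest of the Cayley graph. The Cayley graph is
vertex-transitive, so that the vertex does not matter; it is taken to be the identity. -/
def expectedDegreeFMSF : ℝ≥0∞ := S.cayley.expectedDegree 1

end GeneratingMultiset

end

/-! Let λ be the left regular representation on real ℓ²(Γ), and let S have d elements. If ‖∑ λ(s)⁻¹‖
≤ r d, then at most (r d)^k words of length k in S lead from 1 back to 1. Fix a threshold t. An edge
at 1 with label at most t is cut only if some closed word through it runs over distinct edges all
labelled at most t; for a given word of length k this has probability at most t^k. A word serves at
most two indices s, so a union bound gives d t ≤ δ + 2 ∑_{k ≥ 1} (r d t)^k, and t = 1/(2 r d) yields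
δ ≥ 1/(2r) - 2 (`ofReal_le_expectedDegreeFMSF_add_two`).

It remains to make r small. By non-amenability λ has no almost invariant vectors
(`exists_spectral_gap`), so a finite generating family padded with copies of 1 has ratio ρ < 1 of
norm to cardinality (`exists_isContracting`). Products of families, taken with multiplicity,
multiply the bounds on these ratios (`IsContracting.mul`), and ρ^k tends to 0. Every δ is finite, so
unboundedness forces two different values. -/

/-! ### Amenability and almost invariant vectors in ℓ²(Γ) -/

section RegularRepresentation

open Filter Topology

variable {Γ : Type*}

/-- Real square summable functions. -/
abbrev EllTwo (Γ : Type*) := lp (fun _ : Γ => ℝ) 2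

namespace EllTwo

theorem norm_sq_eq_tsum (f : EllTwo Γ) : ‖f‖ ^ 2 = ∑' x, f x ^ 2 := by
  simpa using lp.norm_rpow_eq_tsum (p := 2) (by norm_num) f

theorem summable_sq (f : EllTwo Γ) : Summable fun x => f x ^ 2 := by
  simpa using (memℓp_gen_iff (p := 2) (by norm_num)).1 (lp.memℓp f)

theorem tsum_abs_mul_le (f g : EllTwo Γ) :
    Summable (fun x => |f x| * |g x|) ∧ ∑' x, |f x| * |g x| ≤ ‖f‖ * ‖g‖ := by
  have h := Real.summable_and_inner_le_Lp_mul_Lq_tsum_of_nonneg (p := 2) (q := 2)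
    Real.HolderConjugate.two_two (f := fun x => |f x|) (g := fun x => |g x|)
    (fun _ => abs_nonneg _) (fun _ => abs_nonneg _)
    (by simpa using summable_sq f) (by simpa using summable_sq g)
  refine ⟨h.1, h.2.trans_eq ?_⟩
  rw [lp.norm_eq_tsum_rpow (p := 2) (by norm_num) f, lp.norm_eq_tsum_rpow (p := 2) (by norm_num) g]
  simp

/-- The mass that the density `f ^ 2` gives to `A`. -/
noncomputable def mass (f : EllTwo Γ) (A : Set Γ) : ℝ := ∑' x, A.indicator (fun x => f x ^ 2) x

theorem mass_nonneg (f : EllTwo Γ) (A : Set Γ) : 0 ≤ mass f A :=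
  tsum_nonneg fun _ => indicator_nonneg (fun _ _ => sq_nonneg _) _

theorem mass_univ (f : EllTwo Γ) : mass f univ = ‖f‖ ^ 2 := by
  simp [mass, norm_sq_eq_tsum]

theorem mass_le (f : EllTwo Γ) (A : Set Γ) : mass f A ≤ ‖f‖ ^ 2 := by
  rw [norm_sq_eq_tsum]
  exact ((summable_sq f).indicator A).tsum_le_tsum
    (fun _ => indicator_le_self' (fun _ _ => sq_nonneg _) _) (summable_sq f)

theorem mass_union (f : EllTwo Γ) {A B : Set Γ} (h : Disjoint A B) :
    mass f (A ∪ B) = mass f A + mass f B := by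
  rw [mass, mass, mass, ← ((summable_sq f).indicator A).tsum_add ((summable_sq f).indicator B),
    indicator_union_of_disjoint h]

/-- Cauchy–Schwarz for f² - h² = (f - h)(f + h). The bound is uniform in `A`, so almost invariant
vectors have almost invariant masses. -/
theorem abs_mass_sub_mass_le (f h : EllTwo Γ) (A : Set Γ) :
    |mass f A - mass h A| ≤ ‖f - h‖ * (‖f‖ + ‖h‖) := by
  have H := tsum_abs_mul_le (f - h) (f + h)
  refine le_trans ?_ (H.2.trans (mul_le_mul_of_nonneg_left (norm_add_le _ _) (norm_nonneg _)))
  rw [mass, mass, ← ((summable_sq f).indicator A).tsum_sub ((summable_sq h).indicator A),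
    ← Real.norm_eq_abs]
  refine tsum_of_norm_bounded H.1.hasSum fun x => ?_
  by_cases hx : x ∈ A
  · simp only [hx, indicator_of_mem, Real.norm_eq_abs, lp.coeFn_sub, lp.coeFn_add, Pi.sub_apply,
      Pi.add_apply, ← abs_mul]
    exact (congrArg abs (by ring)).le
  · simp only [hx, not_false_eq_true, indicator_of_notMem, sub_zero, norm_zero]
    positivity

variable [Group Γ]

/-- The translate `x ↦ f (g⁻¹ * x)`. -/
def translate (g : Γ) (f : EllTwo Γ) : EllTwo Γ :=
  ⟨fun x => f (g⁻¹ * x), (memℓp_gen_iff (p := 2) (by norm_num)).2 <| by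
    simpa [Function.comp_def] using (Equiv.mulLeft g⁻¹).summable_iff.2 (summable_sq f)⟩

theorem norm_translate (g : Γ) (f : EllTwo Γ) : ‖translate g f‖ = ‖f‖ := by
  rw [← sq_eq_sq₀ (norm_nonneg _) (norm_nonneg _), norm_sq_eq_tsum, norm_sq_eq_tsum]
  exact (Equiv.mulLeft g⁻¹).tsum_eq fun x => f x ^ 2

/-- The left regular representation. -/
noncomputable def leftRegular : Γ →* (EllTwo Γ →L[ℝ] EllTwo Γ) where
  toFun g := LinearMap.mkContinuous
    { toFun := translate g
      map_add' := fun _ _ => rfl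
      map_smul' := fun _ _ => rfl } 1 fun f => by
      rw [one_mul]; exact (norm_translate g f).le
  map_one' := by
    ext f x
    exact congrArg f (by simp)
  map_mul' g h := by
    ext f x
    exact congrArg f (by simp [mul_assoc])

@[simp]
theorem leftRegular_apply (g : Γ) (f : EllTwo Γ) (x : Γ) : leftRegular g f x = f (g⁻¹ * x) := rfl

theorem norm_leftRegular_apply (g : Γ) (f : EllTwo Γ) : ‖leftRegular g f‖ = ‖f‖ :=
  norm_translate g f

theorem mass_smul (f : EllTwo Γ) (g : Γ) (A : Set Γ) :
    mass f (g • A) = mass (leftRegular g⁻¹ f) A := by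
  rw [mass, ← (Equiv.mulLeft g).tsum_eq]
  refine tsum_congr fun x => ?_
  by_cases hx : x ∈ A
  · have : g * x ∈ g • A := ⟨x, hx, rfl⟩
    simp [hx, this]
  · have : g * x ∉ g • A := fun h => hx ((smul_mem_smul_set_iff (a := g)).1 h)
    simp [hx, this]

end EllTwo

open EllTwo

variable [Group Γ]

/-- A group with almost invariant unit vectors in its regular representation is amenable. -/
theorem isAmenableGroup_of_tendsto {S : Set Γ} (hS : Subgroup.closure S = ⊤) (f : ℕ → EllTwo Γ)
    (hf : ∀ n, ‖f n‖ = 1)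
    (hlim : ∀ s ∈ S, Tendsto (fun n => ‖leftRegular s (f n) - f n‖) atTop (𝓝 0)) :
    IsAmenableGroup Γ := by
  have hmem : ∀ A n, mass (f n) A ∈ Icc (0 : ℝ) 1 := fun A n =>
    ⟨mass_nonneg _ _, (mass_le _ _).trans_eq (by simp [hf])⟩
  -- The mean is the limit of the masses along one ultrafilter, the same for all `A`, so that
  -- additivity survives in the limit.
  have key : ∀ A : Set Γ, ∃ L ∈ Icc (0 : ℝ) 1,
      Tendsto (fun n => mass (f n) A) (hyperfilter ℕ) (𝓝 L) := fun A => by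
    obtain ⟨L, hL, h⟩ := isCompact_Icc.ultrafilter_le_nhds
      ((hyperfilter ℕ).map fun n => mass (f n) A)
      (le_principal_iff.2 (Ultrafilter.mem_map.2 (univ_mem' (hmem A))))
    exact ⟨L, hL, h⟩
  choose L hL hLt using key
  have hinv : ∀ g : Γ, ∀ A, L (g • A) = L A := by
    intro g
    have hg : g ∈ Subgroup.closure S := hS ▸ Subgroup.mem_top g
    induction hg using Subgroup.closure_induction with
    | mem s hs =>
      intro A
      have h0 : Tendsto (fun n => mass (f n) (s • A) - mass (f n) A) atTop (𝓝 0) := by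
        refine squeeze_zero_norm (fun n => ?_) (by simpa using (hlim s hs).mul_const 2)
        rw [mass_smul, Real.norm_eq_abs]
        refine (abs_mass_sub_mass_le _ _ _).trans_eq ?_
        have h1 : leftRegular s (leftRegular s⁻¹ (f n) - f n) = f n - leftRegular s (f n) := by
          rw [map_sub, ← mul_apply_eq_comp, ← map_mul]
          simp
        rw [← norm_leftRegular_apply s, h1, norm_leftRegular_apply, hf, norm_sub_rev]
        norm_num
      have h1 := tendsto_nhds_unique ((hLt (s • A)).sub (hLt A)) (h0.mono_left Nat.hyperfilter_le_atTop)
      exact sub_eq_zero.1 h1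
    | one => simp
    | mul g h _ _ hg hh => intro A; rw [mul_smul, hg, hh]
    | inv g _ hg => intro A; rw [← hg (g⁻¹ • A), smul_inv_smul]
  refine ⟨fun A => ENNReal.ofReal (L A), ?_, fun A B hAB => ?_, fun g A => congrArg _ (hinv g A)⟩
  · have h : L univ = 1 := tendsto_nhds_unique (hLt univ) (by simp [mass_univ, hf])
    simp [h]
  · have h : L (A ∪ B) = L A + L B := tendsto_nhds_unique (hLt _) <| by
      simpa only [mass_union _ hAB] using (hLt A).add (hLt B)
    simp only [h, ENNReal.ofReal_add (hL A).1 (hL B).1]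

/-- Failure for every ε = 1/(n+1) produces vectors which, once normalised, are almost invariant. -/
theorem exists_spectral_gap {S : Set Γ} (hS : Subgroup.closure S = ⊤) (hna : ¬ IsAmenableGroup Γ) :
    ∃ ε > 0, ∀ f : EllTwo Γ, f ≠ 0 → ∃ s ∈ S, ε * ‖f‖ ≤ ‖leftRegular s f - f‖ := by
  by_contra! h
  choose f hf0 hf using fun n : ℕ => h (1 / (n + 1 : ℝ)) Nat.one_div_pos_of_nat
  have hpos : ∀ n, 0 < ‖f n‖ := fun n => norm_pos_iff.2 (hf0 n)
  refine hna (isAmenableGroup_of_tendsto hS (fun n => ‖f n‖⁻¹ • f n)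
    (fun n => norm_smul_inv_norm (𝕜 := ℝ) (hf0 n)) fun s hs => ?_)
  refine squeeze_zero (fun _ => norm_nonneg _) (fun n => ?_) tendsto_one_div_add_atTop_nhds_zero_nat
  rw [map_smul, ← smul_sub, norm_smul, norm_inv, norm_norm, inv_mul_le_iff₀ (hpos n), mul_comm]
  exact (hf n s hs).le

end RegularRepresentation

/-! ### Generating families with small operator norm -/

section Contracting

variable {Γ : Type*} [Group Γ]

open EllTwo

theorem norm_leftRegular_apply_add_le {ε : ℝ} {g : Γ} {f : EllTwo Γ} (hε : 0 < ε)
    (h : ε * ‖f‖ ≤ ‖leftRegular g f - f‖) :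
    ‖leftRegular g f + f‖ ≤ √(4 - ε ^ 2) * ‖f‖ := by
  have h1 := parallelogram_law_with_norm ℝ (leftRegular g f) f
  rw [norm_leftRegular_apply] at h1
  have h2 : (ε * ‖f‖) ^ 2 ≤ ‖leftRegular g f - f‖ ^ 2 := pow_le_pow_left₀ (by positivity) h 2
  have h3 : ‖leftRegular g f + f‖ ^ 2 ≤ (4 - ε ^ 2) * ‖f‖ ^ 2 := by nlinarith
  have h4 := Real.abs_le_sqrt h3
  rwa [abs_of_nonneg (norm_nonneg _), Real.sqrt_mul' _ (sq_nonneg _),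
    Real.sqrt_sq (norm_nonneg _)] at h4

/-- The summand 1 puts `f` next to its translates, so the parallelogram law improves the trivial
bound 2‖f‖ for one index. That index depends on `f`, but the resulting total does not. -/
theorem norm_sum_leftRegular_add_one_le {n : ℕ} {ε : ℝ} (hε : 0 < ε) (ψ : Fin n → Γ)
    (h : ∀ f : EllTwo Γ, f ≠ 0 → ∃ i, ε * ‖f‖ ≤ ‖leftRegular (ψ i) f - f‖) :
    ‖∑ i, (leftRegular (ψ i) + 1)‖ ≤ 2 * (n - 1) + √(4 - ε ^ 2) := by
  classical
  have hn : 1 ≤ n := by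
    obtain ⟨i, -⟩ := h (lp.single 2 1 1) (norm_pos_iff.1 (by rw [lp.norm_single] <;> simp))
    exact i.pos
  have hn' : (1 : ℝ) ≤ n := by exact_mod_cast hn
  refine ContinuousLinearMap.opNorm_le_bound _ (by have := Real.sqrt_nonneg (4 - ε ^ 2); linarith)
    fun f => ?_
  rcases eq_or_ne f 0 with rfl | hf
  · simp
  obtain ⟨i, hi⟩ := h f hf
  have h2 : ∀ j, ‖leftRegular (ψ j) f + f‖ ≤ 2 * ‖f‖ := fun j =>
    (norm_add_le _ _).trans_eq (by rw [norm_leftRegular_apply]; ring)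
  calc ‖(∑ i, (leftRegular (ψ i) + 1)) f‖ = ‖∑ j, (leftRegular (ψ j) f + f)‖ := by
        simp
    _ ≤ ∑ j, ‖leftRegular (ψ j) f + f‖ := norm_sum_le _ _
    _ = ‖leftRegular (ψ i) f + f‖ + ∑ j ∈ Finset.univ.erase i, ‖leftRegular (ψ j) f + f‖ :=
        (Finset.add_sum_erase _ _ (Finset.mem_univ i)).symm
    _ ≤ √(4 - ε ^ 2) * ‖f‖ + ∑ j ∈ Finset.univ.erase i, 2 * ‖f‖ :=
        add_le_add (norm_leftRegular_apply_add_le hε hi) (Finset.sum_le_sum fun j _ => h2 j)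
    _ = (2 * (n - 1) + √(4 - ε ^ 2)) * ‖f‖ := by
        rw [Finset.sum_const, Finset.card_erase_of_mem (Finset.mem_univ i)]
        simp [Nat.cast_sub hn]
        ring

/-- The sums of the translations by a generating family and by its inverses have norm at most
`r` times the number of summands. -/
structure IsContracting {J : Type*} [Fintype J] (φ : J → Γ) (r : ℝ) : Prop where
  closure_range : Subgroup.closure (range φ) = ⊤
  one_mem : 1 ∈ range φ
  norm_sum_le : ‖∑ j, leftRegular (φ j)‖ ≤ r * Fintype.card J
  norm_sum_inv_le : ‖∑ j, leftRegular (φ j)⁻¹‖ ≤ r * Fintype.card J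

/-- The sum over all products is the product of the two sums. Having 1 in both ranges keeps the
family generating. -/
theorem IsContracting.mul {J K : Type*} [Fintype J] [Fintype K] {φ : J → Γ} {ψ : K → Γ} {r t : ℝ}
    (hφ : IsContracting φ r) (hψ : IsContracting ψ t) :
    IsContracting (fun p : J × K => φ p.1 * ψ p.2) (r * t) where
  closure_range := by
    obtain ⟨k, hk⟩ := hψ.one_mem
    rw [eq_top_iff, ← hφ.closure_range]
    refine Subgroup.closure_mono ?_
    rintro _ ⟨j, rfl⟩
    exact ⟨(j, k), by simp [hk]⟩
  one_mem := by
    obtain ⟨j, hj⟩ := hφ.one_mem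
    obtain ⟨k, hk⟩ := hψ.one_mem
    exact ⟨(j, k), by simp [hj, hk]⟩
  norm_sum_le := by
    simp only [map_mul, Fintype.sum_prod_type, ← Finset.sum_mul_sum]
    refine (norm_mul_le _ _).trans ((mul_le_mul hφ.norm_sum_le hψ.norm_sum_le (norm_nonneg _)
      ((norm_nonneg _).trans hφ.norm_sum_le)).trans_eq ?_)
    rw [Fintype.card_prod]
    push_cast
    ring
  norm_sum_inv_le := by
    simp only [mul_inv_rev, map_mul, Fintype.sum_prod_type_right, ← Finset.sum_mul_sum]
    refine (norm_mul_le _ _).trans ((mul_le_mul hψ.norm_sum_inv_le hφ.norm_sum_inv_le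
      (norm_nonneg _) ((norm_nonneg _).trans hψ.norm_sum_inv_le)).trans_eq ?_)
    rw [Fintype.card_prod]
    push_cast
    ring

theorem exists_isContracting (hfg : Group.FG Γ) (hna : ¬ IsAmenableGroup Γ) :
    ∃ ρ : ℝ, 0 ≤ ρ ∧ ρ < 1 ∧ ∃ (J : Type) (_ : Fintype J) (φ : J → Γ), IsContracting φ ρ := by
  obtain ⟨S, hS, hfin⟩ := Group.fg_iff.1 hfg
  obtain ⟨n, ψ, -, rfl⟩ := hfin.fin_param
  obtain ⟨ε, hε, h⟩ := exists_spectral_gap hS hna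
  have hgap : ∀ f : EllTwo Γ, f ≠ 0 → ∃ i, ε * ‖f‖ ≤ ‖leftRegular (ψ i) f - f‖ := fun f hf => by
    simpa using h f hf
  -- The isometry λ(ψ i) maps λ(ψ i)⁻¹ f - f to f - λ(ψ i) f.
  have hgap' : ∀ f : EllTwo Γ, f ≠ 0 → ∃ i, ε * ‖f‖ ≤ ‖leftRegular (ψ i)⁻¹ f - f‖ := fun f hf => by
    obtain ⟨i, hi⟩ := hgap f hf
    refine ⟨i, hi.trans_eq ?_⟩
    rw [← norm_leftRegular_apply (ψ i) (leftRegular (ψ i)⁻¹ f - f), map_sub, ← mul_apply_eq_comp,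
      ← map_mul, norm_sub_rev]
    simp
  have hn : 0 < n := by
    classical
    obtain ⟨i, -⟩ := hgap (lp.single 2 1 1) (norm_pos_iff.1 (by rw [lp.norm_single] <;> simp))
    exact i.pos
  have hn' : (1 : ℝ) ≤ n := by exact_mod_cast hn
  have hsqrt : √(4 - ε ^ 2) < 2 := (Real.sqrt_lt' two_pos).2 (by nlinarith)
  have h0 := Real.sqrt_nonneg (4 - ε ^ 2)
  have hmul : (2 * (n - 1) + √(4 - ε ^ 2)) / (2 * n) * (n * 2) = 2 * (n - 1) + √(4 - ε ^ 2) := by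
    field_simp
  -- The family consists of the n generators and n copies of 1, so its operator sum is ∑ (λ(ψ i) +
  -- 1), with 2n summands.
  refine ⟨(2 * (n - 1) + √(4 - ε ^ 2)) / (2 * n), div_nonneg (by linarith) (by linarith), ?_,
    Fin n × Bool, inferInstance, fun p => if p.2 then ψ p.1 else 1, ?_, ⟨(⟨0, hn⟩, false), by simp⟩,
    ?_, ?_⟩
  · rw [div_lt_one (by linarith)]
    linarith
  · rw [eq_top_iff, ← hS]
    refine Subgroup.closure_mono ?_
    rintro _ ⟨j, rfl⟩
    exact ⟨(j, true), by simp⟩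
  · simpa [Fintype.sum_prod_type, hmul] using norm_sum_leftRegular_add_one_le hε ψ hgap
  · simpa [Fintype.sum_prod_type, hmul] using
      norm_sum_leftRegular_add_one_le hε (fun i => (ψ i)⁻¹) hgap'

theorem exists_isContracting_pow {J : Type} [Fintype J] {φ : J → Γ} {ρ : ℝ}
    (h : IsContracting φ ρ) (k : ℕ) :
    ∃ (K : Type) (_ : Fintype K) (ψ : K → Γ), IsContracting ψ (ρ ^ (k + 1)) := by
  induction k with
  | zero => exact ⟨J, _, φ, by simpa using h⟩
  | succ k ih =>
    obtain ⟨K, _, ψ, hψ⟩ := ih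
    exact ⟨K × J, inferInstance, _, by simpa only [pow_succ _ (k + 1)] using hψ.mul h⟩

/-- The multi-set consisting of a generating family and its inverses. -/
def GeneratingMultiset.symmetrize {J : Type} [Finite J] (φ : J → Γ)
    (hφ : Subgroup.closure (range φ) = ⊤) : GeneratingMultiset Γ where
  Index := J × Bool
  val p := if p.2 then φ p.1 else (φ p.1)⁻¹
  inv p := (p.1, !p.2)
  inv_inv := by simp
  val_inv := by rintro ⟨j, _ | _⟩ <;> simp
  closure_range := by
    rw [eq_top_iff, ← hφ]
    refine Subgroup.closure_mono ?_
    rintro _ ⟨j, rfl⟩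
    exact ⟨(j, true), by simp⟩
  inv_ne := by simp [Prod.ext_iff]

theorem GeneratingMultiset.exists_norm_sum_le (hfg : Group.FG Γ) (hna : ¬ IsAmenableGroup Γ)
    {r : ℝ} (hr : 0 < r) :
    ∃ (S : GeneratingMultiset Γ) (_ : Fintype S.Index), Nonempty S.Index ∧
      ‖∑ s, leftRegular (S.val s)⁻¹‖ ≤ r * Fintype.card S.Index := by
  obtain ⟨ρ, hρ0, hρ1, J, _, φ, hφ⟩ := exists_isContracting hfg hna
  obtain ⟨k, hk⟩ := exists_pow_lt_of_lt_one hr hρ1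
  obtain ⟨K, _, ψ, hψ⟩ := exists_isContracting_pow hφ k
  have hle : ρ ^ (k + 1) ≤ r := (pow_le_pow_of_le_one hρ0 hρ1.le k.le_succ).trans hk.le
  refine ⟨symmetrize ψ hψ.closure_range, inferInstanceAs (Fintype (K × Bool)), ?_, ?_⟩
  · obtain ⟨j, -⟩ := hψ.one_mem
    exact ⟨(j, true)⟩
  · change ‖∑ p : K × Bool, leftRegular (if p.2 then ψ p.1 else (ψ p.1)⁻¹)⁻¹‖ ≤
      r * Fintype.card (K × Bool)
    simp only [Fintype.sum_prod_type_right, Fintype.sum_bool, Fintype.card_prod,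
      Fintype.card_bool, if_true, Bool.false_eq_true, if_false, _root_.inv_inv]
    refine (norm_add_le _ _).trans ((add_le_add hψ.norm_sum_inv_le hψ.norm_sum_le).trans ?_)
    push_cast
    nlinarith [mul_le_mul_of_nonneg_right hle (Nat.cast_nonneg (α := ℝ) (Fintype.card K))]

end Contracting

/-! ### Counting closed words -/

namespace GeneratingMultiset

variable {Γ : Type*} [Group Γ] (S : GeneratingMultiset Γ)

/-- The end of the walk that starts at `g` and follows the word `w`. -/
def walkEnd : List S.Index → Γ → Γ
  | [], g => g
  | s :: w, g => walkEnd w (S.val s * g)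

/-- The oriented edges of the walk that starts at `g` and follows the word `w`. -/
def walk : List S.Index → Γ → List (Γ × S.Index)
  | [], _ => []
  | s :: w, g => (g, s) :: walk w (S.val s * g)

theorem length_walk (w : List S.Index) (g : Γ) : (S.walk w g).length = w.length := by
  induction w generalizing g with
  | nil => rfl
  | cons s w ih => simp [walk, ih]

open scoped Classical in
/-- The words of length `k` that lead from `g` to `1`. -/
noncomputable def wordsToOne [Fintype S.Index] (k : ℕ) (g : Γ) : Finset (Fin k → S.Index) :=
  {v | S.walkEnd (List.ofFn v) g = 1}

theorem card_wordsToOne_succ [Fintype S.Index] (k : ℕ) (g : Γ) :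
    (S.wordsToOne (k + 1) g).card = ∑ s, (S.wordsToOne k (S.val s * g)).card := by
  classical
  simp only [wordsToOne, Finset.card_filter]
  rw [← (Fin.consEquiv fun _ => S.Index).sum_comp, Fintype.sum_prod_type]
  simp [Fin.consEquiv, List.ofFn_succ, walkEnd]

-- Since (λ(s)⁻¹ f)(g) = f(s g), each application of the operator prepends one letter to the words
-- counted.
open EllTwo in
theorem sum_leftRegular_pow_single_apply [Fintype S.Index] [DecidableEq Γ] (k : ℕ) (g : Γ) :
    ((∑ s, leftRegular (S.val s)⁻¹) ^ k) (lp.single 2 1 1) g = (S.wordsToOne k g).card := by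
  induction k generalizing g with
  | zero =>
    by_cases h : g = 1
    · subst h
      simp [wordsToOne, walkEnd]
    · simp [wordsToOne, walkEnd, h]
  | succ k ih =>
    rw [pow_succ', mul_apply_eq_comp, card_wordsToOne_succ, Nat.cast_sum, sum_apply,
      lp.coeFn_sum, Finset.sum_apply]
    refine Finset.sum_congr rfl fun s _ => ?_
    rw [leftRegular_apply, _root_.inv_inv, ih]

open EllTwo in
theorem card_wordsToOne_le [Fintype S.Index] {R : ℝ}
    (hR : ‖∑ s, leftRegular (S.val s)⁻¹‖ ≤ R) (k : ℕ) : ((S.wordsToOne k 1).card : ℝ) ≤ R ^ k := by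
  classical
  rw [← sum_leftRegular_pow_single_apply]
  refine (Real.le_norm_self _).trans ((lp.norm_apply_le_norm two_ne_zero _ _).trans ?_)
  refine (ContinuousLinearMap.le_opNorm _ _).trans ?_
  rw [lp.norm_single (by norm_num), norm_one, mul_one]
  rcases k.eq_zero_or_pos with rfl | hk
  · rw [pow_zero, pow_zero]
    exact ContinuousLinearMap.norm_id_le
  · exact (norm_pow_le' _ hk).trans (pow_le_pow_left₀ (norm_nonneg _) hR k)

/-- The words s s⁻¹ are closed. This will give r d ≥ 1, so that 1/(2 r d) is a legitimate label. -/
theorem card_index_le_card_wordsToOne [Fintype S.Index] :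
    Fintype.card S.Index ≤ (S.wordsToOne 2 1).card := by
  refine Finset.card_le_card_of_injOn (s := Finset.univ) (fun s => ![s, S.inv s]) ?_ ?_
  · intro s _
    simp [wordsToOne, walkEnd, S.val_inv]
  · intro s _ t _ h
    simpa using congrFun h 0

end GeneratingMultiset

/-! ### Rotating simple cycles -/

namespace OrientedGraph

variable {V O : Type*} {G : OrientedGraph V O}

theorem head_opp (e : O) : G.head (G.opp e) = G.tail e := by
  rw [← G.tail_opp, G.opp_opp]

theorem edge_eq_edge_iff {e f : O} : G.edge e = G.edge f ↔ e = f ∨ e = G.opp f := by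
  constructor
  · intro h
    exact (Sym2.eq_iff.1 (congrArg Subtype.val h)).imp And.left And.left
  · rintro (rfl | rfl)
    · rfl
    · exact Subtype.ext (Sym2.eq_iff.2 (.inr ⟨rfl, G.opp_opp _⟩))

theorem isPath_append {l₁ l₂ : List O} {x z : V} :
    G.IsPath (l₁ ++ l₂) x z ↔ ∃ y, G.IsPath l₁ x y ∧ G.IsPath l₂ y z := by
  induction l₁ generalizing x with
  | nil => simp [IsPath]
  | cons e l ih => simp [IsPath, ih, and_assoc]

theorem IsSimpleCycle.append_comm {l₁ l₂ : List O} (h : G.IsSimpleCycle (l₁ ++ l₂)) :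
    G.IsSimpleCycle (l₂ ++ l₁) := by
  obtain ⟨hne, ⟨x, hx⟩, hnd, hopp⟩ := h
  obtain ⟨y, h₁, h₂⟩ := isPath_append.1 hx
  refine ⟨by simpa [and_comm] using hne, ⟨y, isPath_append.2 ⟨x, h₂, h₁⟩⟩,
    (List.perm_append_comm.map G.tail).nodup_iff.1 hnd, fun e he => ?_⟩
  have hlen := congrArg List.length he
  match l₁, l₂, hopp, he with
  | [], _, hopp, he => exact hopp e (by simpa using he)
  | [a], [b], hopp, he =>
    simp only [List.cons_append, List.nil_append, List.cons.injEq, and_true] at he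
    exact hopp a (by simp [he.1, he.2, G.opp_opp])
  | _ :: _, [], hopp, he => exact hopp e (by simpa using he)
  | a :: b :: l, c :: l', hopp, he => simp at hlen; omega
  | a :: l, b :: c :: l', hopp, he => simp at hlen

/-- If `opp e` occurs later, its tail is the head of `e`, so it comes directly after `e`. The path
is then back at the tail of `e` and must stop, which is the excluded cycle. -/
theorem IsSimpleCycle.edge_ne_of_mem {e f : O} {l : List O} (h : G.IsSimpleCycle (e :: l))
    (hf : f ∈ l) : G.edge e ≠ G.edge f := by
  intro hef
  obtain ⟨-, ⟨x, he, hp⟩, hnd, hopp⟩ := h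
  rcases edge_eq_edge_iff.1 hef with rfl | rfl
  · exact (List.nodup_cons.1 hnd).1 (List.mem_map_of_mem hf)
  · match l, hf with
    | g :: l, hf =>
      obtain ⟨hg, hp⟩ := hp
      rw [head_opp] at hg
      have hgf : f = g := by
        rcases List.mem_cons.1 hf with rfl | hf
        · rfl
        · exact absurd (hg ▸ List.mem_map_of_mem hf)
            (List.nodup_cons.1 (List.nodup_cons.1 hnd).2).1
      subst hgf
      match l, hp with
      | [], _ => exact hopp (G.opp f) (by simp [G.opp_opp])
      | a :: l, ⟨ha, _⟩ =>
        refine (List.nodup_cons.1 hnd).1 ?_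
        simp [ha, G.tail_opp]

theorem IsSimpleCycle.nodup_map_edge {l : List O} (h : G.IsSimpleCycle l) :
    (l.map G.edge).Nodup := by
  refine List.Nodup.map_on (fun e he f hf hef => ?_) (List.Nodup.of_map _ h.2.2.1)
  obtain ⟨l₁, l₂, rfl⟩ := List.append_of_mem he
  by_contra hne
  refine h.append_comm.edge_ne_of_mem (f := f) ?_ hef
  have : f ≠ e := fun h => hne h.symm
  simp only [List.mem_append, List.mem_cons, this, false_or] at hf
  exact List.mem_append.2 hf.symm

/-- A simple cycle through `e` or `opp e` can be rotated so that it starts with `e` or ends with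
`opp e`. -/
theorem IsSimpleCycle.exists_rotation {l : List O} (h : G.IsSimpleCycle l) {e f : O} (hf : f ∈ l)
    (hfe : G.edge f = G.edge e) :
    ∃ l', G.IsSimpleCycle l' ∧ l'.Perm l ∧ G.IsPath l' (G.tail e) (G.tail e) ∧
      (l'.head? = some e ∨ l'.getLast? = some (G.opp e)) := by
  obtain ⟨l₁, l₂, rfl⟩ := List.append_of_mem hf
  rcases edge_eq_edge_iff.1 hfe with rfl | rfl
  · have h' := h.append_comm
    refine ⟨_, h', List.perm_append_comm, ?_, .inl rfl⟩
    obtain ⟨x, hx⟩ := h'.2.1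
    obtain rfl : G.tail f = x := hx.1
    exact hx
  · have h' : G.IsSimpleCycle ((l₂ ++ l₁) ++ [G.opp e]) := by
      have h₂ : G.IsSimpleCycle ((l₁ ++ [G.opp e]) ++ l₂) := by simpa using h
      simpa using h₂.append_comm
    refine ⟨_, h', ?_, ?_, .inr (by simp)⟩
    · simpa using List.perm_append_comm (l₁ := l₂) (l₂ := l₁ ++ [G.opp e])
    · obtain ⟨x, hx⟩ := h'.2.1
      obtain ⟨y, -, -, hy⟩ := isPath_append.1 hx
      rw [head_opp] at hy
      obtain rfl : G.tail e = x := hy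
      exact hx

end OrientedGraph

/-! ### From cut edges to closed words -/

namespace GeneratingMultiset

variable {Γ : Type*} [Group Γ] (S : GeneratingMultiset Γ)

theorem eq_walk_of_isPath {l : List (Γ × S.Index)} {g h : Γ} (hl : S.cayley.IsPath l g h) :
    l = S.walk (l.map Prod.snd) g ∧ S.walkEnd (l.map Prod.snd) g = h := by
  induction l generalizing g with
  | nil => exact ⟨rfl, hl⟩
  | cons e l ih =>
    obtain ⟨g', s⟩ := e
    obtain ⟨rfl, hl⟩ : g' = g ∧ S.cayley.IsPath l (S.val s * g') h := hl
    obtain ⟨h₁, h₂⟩ := ih hl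
    exact ⟨congrArg _ h₁, h₂⟩

/-- The word `w` starts with `s` or ends with `s⁻¹`. -/
def StartsOrEnds (w : List S.Index) (s : S.Index) : Prop :=
  w.head? = some s ∨ w.getLast? = some (S.inv s)

/-- The cycle may traverse the edge in either direction; rotating it to be based at 1 puts the edge
first or last. Distinctness of the edges is kept for the sake of independence. -/
theorem exists_word_of_isCut {x : S.cayley.Edge → unitInterval} {s : S.Index}
    (h : S.cayley.IsCut x (S.cayley.edge (1, s))) :
    ∃ w : List S.Index, w ≠ [] ∧ S.walkEnd w 1 = 1 ∧ S.StartsOrEnds w s ∧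
      ((S.walk w 1).map S.cayley.edge).Nodup ∧
      ∀ f ∈ S.walk w 1, x (S.cayley.edge f) ≤ x (S.cayley.edge (1, s)) := by
  obtain ⟨l, hl, ⟨f, hf, hfe⟩, hx⟩ := h
  obtain ⟨l', hl', hperm, hpath, hends⟩ := hl.exists_rotation hf hfe
  obtain ⟨h₁, h₂⟩ := S.eq_walk_of_isPath (g := 1) (h := 1) hpath
  refine ⟨l'.map Prod.snd, by simpa using hl'.1, h₂, ?_, ?_, ?_⟩
  · rcases hends with h | h
    · exact .inl (by simp [h])
    · exact .inr (by simp [h, cayley])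
  · rw [← h₁]
    exact hl'.nodup_map_edge
  · rw [← h₁]
    exact fun f hf => hx f (hperm.subset hf)

open scoped Classical in
theorem card_startsOrEnds_le [Fintype S.Index] {w : List S.Index} (hw : w ≠ []) :
    (Finset.univ.filter (S.StartsOrEnds w)).card ≤ 2 := by
  refine (Finset.card_le_card (t := {w.head hw, S.inv (w.getLast hw)}) fun s hs => ?_).trans
    Finset.card_le_two
  rcases (Finset.mem_filter.1 hs).2 with h | h
  · rw [List.head?_eq_some_head hw, Option.some_inj] at h
    simp [h]
  · rw [List.getLast?_eq_some_getLast hw, Option.some_inj] at h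
    simp [h, S.inv_inv]

end GeneratingMultiset

/-! ### Random labels -/

namespace OrientedGraph

variable {V O : Type*} (G : OrientedGraph V O)

/-- The law of independent uniformly distributed labels. -/
noncomputable abbrev labelMeasure : Measure (G.Edge → unitInterval) :=
  Measure.infinitePi fun _ : G.Edge => (volume : Measure unitInterval)

/-- There are only countably many lists of oriented edges. -/
theorem measurableSet_isCut [Countable O] (a : G.Edge) : MeasurableSet {x | G.IsCut x a} := by
  refine measurableSet_setOfPred.2 (Measurable.exists fun l => measurable_const.and
    (measurable_const.and (Measurable.forall fun f => measurable_const.imp ?_)))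
  exact measurableSet_setOfPred.1 (measurableSet_le (measurable_pi_apply _) (measurable_pi_apply _))

theorem measurable_survivors [Countable O] : Measurable G.survivors :=
  measurable_set_iff.2 fun a => measurableSet_setOfPred.1 (G.measurableSet_isCut a).compl

theorem labelMeasure_forall_le {l : List O} (hl : (l.map G.edge).Nodup) (t : unitInterval) :
    G.labelMeasure {x | ∀ f ∈ l, x (G.edge f) ≤ t} = ENNReal.ofReal t ^ l.length := by
  classical
  have h : {x : G.Edge → unitInterval | ∀ f ∈ l, x (G.edge f) ≤ t} =
      Set.pi (l.map G.edge).toFinset fun _ => Iic t := by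
    ext x
    simp [Set.mem_pi]
  rw [h, Measure.infinitePi_pi _ fun _ _ => measurableSet_Iic]
  simp [unitInterval.volume_Iic, List.toFinset_card_of_nodup hl]

theorem labelMeasure_le (a : G.Edge) (t : unitInterval) :
    G.labelMeasure {x | x a ≤ t} = ENNReal.ofReal t := by
  obtain ⟨e, he⟩ : ∃ e, G.edge e = a := by
    obtain ⟨_, e, rfl⟩ := a
    exact ⟨e, rfl⟩
  simpa [he] using G.labelMeasure_forall_le (l := [e]) (by simp) t

end OrientedGraph

/-! ### Bounds for the expected degree -/

namespace GeneratingMultiset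

variable {Γ : Type*} [Group Γ] (S : GeneratingMultiset Γ)

theorem degreeIn_eq_sum [Fintype S.Index] (ω : Set S.cayley.Edge) :
    (S.cayley.degreeIn ω 1 : ℝ≥0∞) =
      ∑ s, {ω : Set S.cayley.Edge | S.cayley.edge (1, s) ∈ ω}.indicator 1 ω := by
  classical
  have h : {e : Γ × S.Index | S.cayley.tail e = 1 ∧ S.cayley.edge e ∈ ω} =
      Prod.mk 1 '' ((Finset.univ.filter fun s => S.cayley.edge (1, s) ∈ ω : Finset S.Index) :
        Set S.Index) := by
    ext ⟨g, s⟩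
    constructor
    · rintro ⟨h₁, h⟩
      obtain rfl : g = 1 := h₁
      exact ⟨s, by simpa using h, rfl⟩
    · rintro ⟨s, h, ⟨⟩⟩
      exact ⟨rfl, by simpa using h⟩
  rw [OrientedGraph.degreeIn, h, (Prod.mk_right_injective _).encard_image,
    Set.encard_coe_eq_coe_finsetCard, ENat.toENNReal_coe, Finset.card_filter]
  simp [indicator_apply]

theorem expectedDegreeFMSF_eq_sum [Countable Γ] [Fintype S.Index] :
    S.expectedDegreeFMSF =
      ∑ s, S.cayley.labelMeasure {x | S.cayley.IsCut x (S.cayley.edge (1, s))}ᶜ := by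
  have hm : ∀ s, MeasurableSet {ω : Set S.cayley.Edge | S.cayley.edge (1, s) ∈ ω} :=
    fun s => measurableSet_setOfPred.2 (measurable_set_mem _)
  simp only [expectedDegreeFMSF, OrientedGraph.expectedDegree, degreeIn_eq_sum]
  rw [lintegral_finsetSum _ fun s _ => measurable_one.indicator (hm s)]
  refine Finset.sum_congr rfl fun s _ => ?_
  rw [lintegral_indicator_one (hm s), OrientedGraph.FMSF,
    Measure.map_apply S.cayley.measurable_survivors (hm s)]
  rfl

-- The event that the edge has label at most `t` is covered by its survival and, for each closed
-- word starting or ending in it, the event that the word has distinct edges with labels at most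
-- `t`.
open scoped Classical in
theorem ofReal_le_measure_not_isCut_add [Fintype S.Index] (s : S.Index) (t : unitInterval) :
    ENNReal.ofReal t ≤ S.cayley.labelMeasure {x | S.cayley.IsCut x (S.cayley.edge (1, s))}ᶜ +
      ∑' k, ∑ v ∈ S.wordsToOne (k + 1) 1,
        if S.StartsOrEnds (List.ofFn v) s then ENNReal.ofReal t ^ (k + 1) else 0 := by
  let A (w : List S.Index) : Set (S.cayley.Edge → unitInterval) :=
    {x | S.StartsOrEnds w s ∧ ((S.walk w 1).map S.cayley.edge).Nodup ∧
      ∀ f ∈ S.walk w 1, x (S.cayley.edge f) ≤ t}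
  have hA : ∀ w, S.cayley.labelMeasure (A w) ≤
      if S.StartsOrEnds w s then ENNReal.ofReal t ^ w.length else 0 := fun w => by
    split_ifs with h
    · by_cases hnd : ((S.walk w 1).map S.cayley.edge).Nodup
      · refine (measure_mono fun x hx => hx.2.2).trans_eq
          ((S.cayley.labelMeasure_forall_le hnd t).trans ?_)
        rw [length_walk]
      · simp [A, hnd]
    · simp [A, h]
  have hsub : {x : S.cayley.Edge → unitInterval | x (S.cayley.edge (1, s)) ≤ t} ⊆
      {x | S.cayley.IsCut x (S.cayley.edge (1, s))}ᶜ ∪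
        ⋃ k, ⋃ v ∈ S.wordsToOne (k + 1) 1, A (List.ofFn v) := by
    intro x hx
    by_cases hcut : S.cayley.IsCut x (S.cayley.edge (1, s))
    · obtain ⟨w, hw, hend, hs, hnd, hle⟩ := S.exists_word_of_isCut hcut
      obtain ⟨k, hk⟩ := Nat.exists_eq_add_one.2 (List.length_pos_iff.2 hw)
      obtain ⟨v, rfl⟩ : ∃ v : Fin (k + 1) → S.Index, List.ofFn v = w :=
        ⟨fun i => w.get (i.cast hk.symm), by rw [← List.ofFn_congr hk, List.ofFn_get]⟩
      refine .inr (mem_iUnion.2 ⟨k, mem_iUnion₂.2 ⟨v, ?_, hs, hnd, fun f hf => (hle f hf).trans hx⟩⟩)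
      simpa [wordsToOne] using hend
    · exact .inl hcut
  refine (S.cayley.labelMeasure_le (S.cayley.edge (1, s)) t).symm.le.trans ?_
  refine (measure_mono hsub).trans ((measure_union_le _ _).trans (add_le_add_right ?_ _))
  refine (measure_iUnion_le _).trans (ENNReal.tsum_le_tsum fun k => ?_)
  refine (measure_biUnion_finset_le _ _).trans (Finset.sum_le_sum fun v _ => ?_)
  exact (hA _).trans_eq (by rw [List.length_ofFn])

/-- Sum the previous bound over `s` and exchange the sums: each word is charged to at most two
indices. -/
theorem card_mul_le_expectedDegreeFMSF_add [Countable Γ] [Fintype S.Index] (t : unitInterval) :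
    Fintype.card S.Index * ENNReal.ofReal t ≤ S.expectedDegreeFMSF +
      ∑' k, 2 * ((S.wordsToOne (k + 1) 1).card * ENNReal.ofReal t ^ (k + 1)) := by
  classical
  rw [expectedDegreeFMSF_eq_sum]
  calc (Fintype.card S.Index * ENNReal.ofReal t : ℝ≥0∞)
      = ∑ s : S.Index, ENNReal.ofReal t := by simp
    _ ≤ _ := Finset.sum_le_sum fun s _ => S.ofReal_le_measure_not_isCut_add s t
    _ ≤ _ := by
      rw [Finset.sum_add_distrib]
      refine add_le_add_right ?_ _
      rw [← Summable.tsum_finsetSum fun _ _ => ENNReal.summable]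
      refine ENNReal.tsum_le_tsum fun k => ?_
      rw [Finset.sum_comm, mul_left_comm, ← nsmul_eq_mul]
      refine Finset.sum_le_card_nsmul _ _ _ fun v _ => ?_
      rw [← Finset.sum_filter, Finset.sum_const, nsmul_eq_mul]
      gcongr
      exact_mod_cast S.card_startsOrEnds_le (w := List.ofFn v) (by simp)

theorem expectedDegreeFMSF_lt_top [Countable Γ] : S.expectedDegreeFMSF < ∞ := by
  have := S.finite
  have := Fintype.ofFinite S.Index
  rw [expectedDegreeFMSF_eq_sum]
  exact ENNReal.sum_lt_top.2 fun s _ => measure_lt_top _ _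

open EllTwo in
/-- If the sum of the translations by a multi-set has norm at most `r` times the number of
summands, then the expected degree is at least `(2 * r)⁻¹ - 2`. -/
theorem ofReal_le_expectedDegreeFMSF_add_two [Countable Γ] [Fintype S.Index] [Nonempty S.Index]
    {r : ℝ} (h : ‖∑ s, leftRegular (S.val s)⁻¹‖ ≤ r * Fintype.card S.Index) :
    ENNReal.ofReal (2 * r)⁻¹ ≤ S.expectedDegreeFMSF + 2 := by
  set d := Fintype.card S.Index
  have hd : (1 : ℝ) ≤ d := by exact_mod_cast Fintype.card_pos (α := S.Index)
  have hR0 : 0 ≤ r * d := (norm_nonneg _).trans h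
  have hR : 1 ≤ r * d := by
    have h₁ : (d : ℝ) ≤ (S.wordsToOne 2 1).card := by exact_mod_cast S.card_index_le_card_wordsToOne
    have h₂ := S.card_wordsToOne_le h 2
    nlinarith
  have hr : 0 < r := by
    by_contra! hr
    nlinarith
  -- With this choice r d t = 1/2, so the series over k ≥ 1 sums to at most 1.
  let t : unitInterval := ⟨(2 * (r * d))⁻¹, by positivity, inv_le_one_of_one_le₀ (by linarith)⟩
  have ht : (t : ℝ) = (2 * (r * d))⁻¹ := rfl
  have key := S.card_mul_le_expectedDegreeFMSF_add t
  have hdt : (d : ℝ≥0∞) * ENNReal.ofReal t = ENNReal.ofReal (2 * r)⁻¹ := by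
    rw [← ENNReal.ofReal_natCast, ← ENNReal.ofReal_mul (by positivity), ht]
    congr 1
    field_simp
  have hsum : ∑' k, 2 * ((S.wordsToOne (k + 1) 1).card * ENNReal.ofReal t ^ (k + 1)) ≤ 2 := by
    rw [ENNReal.tsum_mul_left]
    refine mul_le_of_le_one_right' ?_
    have hgeo : ∑' k : ℕ, (2⁻¹ : ℝ≥0∞) ^ (k + 1) = 1 := by
      rw [ENNReal.tsum_geometric_add_one, ENNReal.one_sub_inv_two, _root_.inv_inv]
      exact ENNReal.inv_mul_cancel two_ne_zero ENNReal.ofNat_ne_top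
    rw [← hgeo]
    refine ENNReal.tsum_le_tsum fun k => ?_
    have h2 : (2⁻¹ : ℝ≥0∞) = ENNReal.ofReal (r * d * t) := by
      rw [ht, show r * d * (2 * (r * d))⁻¹ = (2 : ℝ)⁻¹ by field_simp,
        ENNReal.ofReal_inv_of_pos two_pos, ENNReal.ofReal_ofNat]
    rw [h2, ENNReal.ofReal_mul hR0, mul_pow, ← ENNReal.ofReal_pow hR0, ← ENNReal.ofReal_natCast]
    gcongr
    exact S.card_wordsToOne_le h (k + 1)
  rw [← hdt]
  exact key.trans (add_le_add_right hsum _)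

theorem exists_le_expectedDegreeFMSF [Countable Γ] (hfg : Group.FG Γ) (hna : ¬ IsAmenableGroup Γ)
    (n : ℕ) : ∃ S : GeneratingMultiset Γ, (n : ℝ≥0∞) ≤ S.expectedDegreeFMSF := by
  -- This r makes (2r)⁻¹ = n + 2, which absorbs the loss of 2.
  obtain ⟨S, _, _, h⟩ := exists_norm_sum_le hfg hna (r := (2 * (n + 2))⁻¹) (by positivity)
  refine ⟨S, ENNReal.le_of_add_le_add_right ENNReal.ofNat_ne_top
    (le_trans (le_of_eq ?_) (S.ofReal_le_expectedDegreeFMSF_add_two h))⟩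
  rw [show (2 * (2 * ((n : ℝ) + 2))⁻¹)⁻¹ = ((n + 2 : ℕ) : ℝ) by push_cast; field_simp,
    ENNReal.ofReal_natCast]
  push_cast
  rfl

end GeneratingMultiset

theorem corollary2 (Γ : Type*) [Group Γ] (hfg : Group.FG Γ) (hna : ¬ IsAmenableGroup Γ) :
    (∃ S T : GeneratingMultiset Γ, S.expectedDegreeFMSF ≠ T.expectedDegreeFMSF) ∧
      ∀ n : ℕ, ∃ S : GeneratingMultiset Γ,
        (n : ℝ≥0∞) ≤ S.expectedDegreeFMSF ∧ S.expectedDegreeFMSF < ∞ := by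
  have : Countable Γ := by
    obtain ⟨S, hS, φ, hφ⟩ :=
      Monoid.fg_iff_exists_freeMonoid_hom_surjective.1 (Group.fg_iff_monoid_fg.1 hfg)
    have := hS.countable.to_subtype
    exact (show Function.Surjective (fun l : List S => φ (FreeMonoid.ofList l)) from hφ).countable
  have h : ∀ n : ℕ, ∃ S : GeneratingMultiset Γ,
      (n : ℝ≥0∞) ≤ S.expectedDegreeFMSF ∧ S.expectedDegreeFMSF < ∞ := fun n =>
    (GeneratingMultiset.exists_le_expectedDegreeFMSF hfg hna n).imp
      fun S hS => ⟨hS, S.expectedDegreeFMSF_lt_top⟩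
  refine ⟨?_, h⟩
  obtain ⟨S, -, hS⟩ := h 0
  obtain ⟨n, hn⟩ := ENNReal.exists_nat_gt hS.ne
  obtain ⟨T, hT, -⟩ := h n
  exact ⟨S, T, (hn.trans_le hT).ne⟩
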